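/- Let $G$ be a finite simple graph that is $3$-connected (that is, $G$ has more than $3$ vertices, and deleting any at most two vertices leaves a connected graph) and has an odd number of vertices. If $G$ has at least two vertices of even degree, then $\chi'_o(G)\le 3$. Here $G$ is odd $k$-edge-colorable if there is a (not necessarily proper) edge-coloring $E(G)\to\{1,\dots,k\}$ such that, for each non-empty color class, every vertex of the subgraph induced by that class (its edges together with their end vertices) has odd degree in that subgraph. The odd chromatic index $\chi'_o(G)$ is the minimum $k$ for which $G$ is odd $k$-edge-colorable. -/

import Mathlib

namespace SimpleGraph

/-- `G` is `k`-vertex-connected: it has more than `k` vertices, and deleting any fewer than `k`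
vertices leaves a connected graph. -/
def IsVertexConnected {V : Type*} (G : SimpleGraph V) (k : ℕ) : Prop :=
  (k : ℕ∞) < ENat.card V ∧
    ∀ S : Finset V, S.card < k → (G.induce ((S : Set V)ᶜ)).Connected

/-- An odd subgraph of `G`: every vertex of the subgraph has odd degree in it. -/
def Subgraph.IsOdd {V : Type*} {G : SimpleGraph V} (H : G.Subgraph) : Prop :=
  ∀ v ∈ H.verts, Odd (H.neighborSet v).ncard

/-- The subgraph of `G` induced by a set `F` of edges: its edges are those in `F`, and its
vertices are the ends of these edges. -/
def edgeInducedSubgraph {V : Type*} (G : SimpleGraph V) (F : Set G.edgeSet) : G.Subgraph where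
  verts := {v | ∃ e ∈ F, v ∈ (e : Sym2 V)}
  Adj v w := ∃ e ∈ F, (e : Sym2 V) = s(v, w)
  adj_sub := by
    rintro v w ⟨e, -, he⟩
    rw [← mem_edgeSet, ← he]
    exact e.2
  edge_vert := by
    rintro v w ⟨e, heF, he⟩
    exact ⟨e, heF, by rw [he]; exact Sym2.mem_mk_left v w⟩
  symm := ⟨by
    rintro v w ⟨e, heF, he⟩
    exact ⟨e, heF, he.trans Sym2.eq_swap⟩⟩

/-- `G` is odd `k`-edge-colorable: there is a (not necessarily proper) coloring of its edges with
`k` colors such that each non-empty color class induces an odd subgraph. -/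
def OddEdgeColorable {V : Type*} (G : SimpleGraph V) (k : ℕ) : Prop :=
  ∃ c : G.edgeSet → Fin k, ∀ i : Fin k, (c ⁻¹' {i}).Nonempty →
    (G.edgeInducedSubgraph (c ⁻¹' {i})).IsOdd

/-- The odd chromatic index: the least `k` for which `G` is odd `k`-edge-colorable
(`⊤` if there is none). -/
noncomputable def oddChromaticIndex {V : Type*} (G : SimpleGraph V) : ℕ∞ :=
  ⨅ k ∈ {k : ℕ | G.OddEdgeColorable k}, (k : ℕ∞)

end SimpleGraph

/-! Choose `A` minimal such that `A` and its complement are connected, the complement is non-empty,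
and `A` contains two vertices of even degree. Minimality and 3-connectivity force every vertex of
`A` to have a neighbour outside `A`. They also force `A` to contain exactly two even vertices `s`,
`t`, with `s` having a single neighbour `p` in `A` (`IsVertexConnected.exists_nonseparating`).

Now take a spanning tree of `V \ {s, t}` that uses no edge inside `A`. The first colour class starts
from the edges that avoid `t`, do not lie inside `A` and are off the tree. Flipping tree edges makes
it odd at every vertex except `t`, which it misses; the parities allow this because `|V| - 1` is
even.

The remaining graph `K` has only the edge `sp` at `s`, has even degrees on the rest of `A`, and
outside `A` has only forest edges and edges to `t`. Colouring the forest from its roots makes both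
remaining classes good outside `A` (`exists_oddFibers_of_parent`). Flipping colours along edges
inside `A` then repairs `A \ {s}` (`exists_sum_eq`), and `s` absorbs the leftover parity because a
single edge is odd in either colour. -/

namespace SimpleGraph

/-! ### Connectivity inside vertex sets -/

variable {V : Type*}

/-- The edges of `G` with both ends in `S`, as a graph on all vertices. -/
def within (G : SimpleGraph V) (S : Set V) : SimpleGraph V where
  Adj a b := G.Adj a b ∧ a ∈ S ∧ b ∈ S
  symm := ⟨fun _ _ h => ⟨h.1.symm, h.2.2, h.2.1⟩⟩
  loopless := ⟨fun _ h => h.1.ne rfl⟩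

/-- Any two vertices of `S` are joined by a walk inside `S`. -/
def ConnectedOn (G : SimpleGraph V) (S : Set V) : Prop :=
  ∀ x ∈ S, ∀ y ∈ S, (G.within S).Reachable x y

variable {G : SimpleGraph V} {S T : Set V} {x y : V}

theorem within_mono (h : S ⊆ T) : G.within S ≤ G.within T :=
  fun _ _ hab => ⟨hab.1, h hab.2.1, h hab.2.2⟩

/-- Head induction on reachability. -/
theorem Reachable.head_induction {H : SimpleGraph V} {P : V → Prop} (h : H.Reachable x y)
    (base : P y) (step : ∀ a b, H.Adj a b → H.Reachable b y → P b → P a) : P x := by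
  obtain ⟨p⟩ := h
  induction p with
  | nil => exact base
  | cons hab p ih => exact step _ _ hab ⟨p⟩ (ih base step)

theorem mem_of_reachable_within (h : (G.within S).Reachable x y) (hy : y ∈ S) : x ∈ S :=
  h.head_induction (P := fun x => x ∈ S) hy fun _ _ hab _ _ => hab.2.1

theorem connectedOn_of_reachable (h : ∀ x ∈ S, (G.within S).Reachable x y) : G.ConnectedOn S :=
  fun a ha b hb => (h a ha).trans (h b hb).symm

theorem connectedOn_component (S : Set V) (y : V) :
    G.ConnectedOn {x | (G.within S).Reachable x y} := by
  refine connectedOn_of_reachable (y := y) fun x hx => ?_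
  refine Reachable.head_induction (P := fun x =>
    (G.within {x | (G.within S).Reachable x y}).Reachable x y) hx (Reachable.refl y) ?_
  intro a b hab hb ih
  exact Reachable.trans (Adj.reachable (G := G.within _) ⟨hab.1, hab.reachable.trans hb, hb⟩) ih

theorem IsVertexConnected.connectedOn {k : ℕ} (hG : G.IsVertexConnected k) (S : Finset V)
    (hS : S.card < k) : G.ConnectedOn ((S : Set V)ᶜ) := by
  intro x hx y hy
  have h := (hG.2 S hS).preconnected ⟨x, hx⟩ ⟨y, hy⟩
  refine h.head_induction (P := fun z => (G.within ((S : Set V)ᶜ)).Reachable z.1 y)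
    (Reachable.refl y) ?_
  intro a b hab _ ih
  exact Reachable.trans (Adj.reachable (G := G.within _) ⟨hab, a.2, b.2⟩) ih

/-- A set of vertices with a non-adjacent vertex outside has many neighbours. -/
theorem IsVertexConnected.le_card_boundary [Fintype V] {k : ℕ} (hG : G.IsVertexConnected k)
    {B : Set V} {b c : V} (hb : b ∈ B) (hc : c ∉ B) (hcB : ∀ x ∈ B, ¬ G.Adj x c)
    (N : Finset V) (hN : ∀ w, w ∈ N ↔ w ∉ B ∧ ∃ x ∈ B, G.Adj x w) : k ≤ N.card := by
  by_contra! hlt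
  have hbN : b ∉ N := fun h => ((hN b).1 h).1 hb
  have hcN : c ∉ N := fun h => by
    obtain ⟨x, hx, hxc⟩ := ((hN c).1 h).2
    exact hcB x hx hxc
  have hreach := hG.connectedOn N hlt c (by simpa using hcN) b (by simpa using hbN)
  refine hc (hreach.head_induction (P := fun x => x ∈ B) hb ?_)
  intro a d had _ hd
  by_contra ha
  exact had.2.1 ((hN a).2 ⟨ha, d, hd, had.1.symm⟩)

/-- Of two distinct neighbours of a connected set `B`, one can be avoided on the way to `B`. -/
theorem reachable_avoiding_one {A B : Set V} {b u v : V} (hB : G.ConnectedOn B) (hBA : B ⊆ A)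
    (hb : b ∈ B) (huA : u ∈ A) (hvA : v ∈ A) (huB : u ∉ B) (hvB : v ∉ B) (huv : u ≠ v)
    (hu : ∃ w ∈ B, G.Adj w u) (hv : ∃ w ∈ B, G.Adj w v) (hx : (G.within A).Reachable x b) :
    (G.within (A \ {u})).Reachable x b ∨ (G.within (A \ {v})).Reachable x b := by
  have hBu : B ⊆ A \ {u} := fun w hw => ⟨hBA hw, fun h => huB (h ▸ hw)⟩
  have hBv : B ⊆ A \ {v} := fun w hw => ⟨hBA hw, fun h => hvB (h ▸ hw)⟩
  refine hx.head_induction (P := fun x => (G.within (A \ {u})).Reachable x b ∨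
    (G.within (A \ {v})).Reachable x b) (Or.inl (Reachable.refl b)) ?_
  intro a d had _ ih
  -- A walk that hits `u` can step straight into `B`, thereby avoiding `v`; symmetrically for `v`.
  by_cases hau : a = u
  · subst hau
    obtain ⟨w, hw, hwu⟩ := hu
    exact Or.inr (Reachable.trans (Adj.reachable (G := G.within _) ⟨hwu.symm, ⟨huA, huv⟩, hBv hw⟩)
      ((hB w hw b hb).mono (within_mono hBv)))
  by_cases hav : a = v
  · subst hav
    obtain ⟨w, hw, hwv⟩ := hv
    exact Or.inl (Reachable.trans (Adj.reachable (G := G.within _) ⟨hwv.symm, ⟨hvA, huv.symm⟩, hBu hw⟩)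
      ((hB w hw b hb).mono (within_mono hBu)))
  refine ih.imp (fun h => ?_) (fun h => ?_)
  · exact Reachable.trans (Adj.reachable (G := G.within _)
      ⟨had.1, ⟨had.2.1, hau⟩, mem_of_reachable_within h (hBu hb)⟩) h
  · exact Reachable.trans (Adj.reachable (G := G.within _)
      ⟨had.1, ⟨had.2.1, hav⟩, mem_of_reachable_within h (hBv hb)⟩) h

/-- A set of vertices all joined to a root `r` carries a tree directed towards `r`. -/
theorem exists_parent {H : SimpleGraph V} {W : Set V} {r : V} (h : ∀ x ∈ W, H.Reachable x r) :
    ∃ (par : V → V) (rank : V → ℕ),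
      ∀ x ∈ W, x ≠ r → H.Adj x (par x) ∧ rank (par x) < rank x := by
  have key : ∀ x, ∃ y, x ∈ W → x ≠ r → H.Adj x y ∧ H.dist y r < H.dist x r := by
    intro x
    by_cases hx : x ∈ W ∧ x ≠ r
    · obtain ⟨p, hp⟩ := (h x hx.1).exists_walk_length_eq_dist
      cases p with
      | nil => exact absurd rfl hx.2
      | @cons _ y _ hxy q =>
        refine ⟨y, fun _ _ => ⟨hxy, ?_⟩⟩
        have := SimpleGraph.dist_le q
        rw [Walk.length_cons] at hp
        omega
    · exact ⟨x, fun h1 h2 => absurd ⟨h1, h2⟩ hx⟩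
  choose par hpar using key
  exact ⟨par, fun x => H.dist x r, hpar⟩

/-! ### The minimal set `A` -/

section Splitting

variable {P : V → Prop} {A : Set V}

/-- `A` and its complement are connected and non-empty, and `A` has two vertices with `P`. -/
structure IsSplitting (G : SimpleGraph V) (P : V → Prop) (A : Set V) : Prop where
  connected : G.ConnectedOn A
  compl_connected : G.ConnectedOn Aᶜ
  compl_nonempty : Aᶜ.Nonempty
  two : ∃ x ∈ A, ∃ y ∈ A, x ≠ y ∧ P x ∧ P y

/-- Otherwise the component of `t` in `A \ {w}` is a smaller splitting: what is left of `A` still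
hangs on `w`, which is adjacent to `Aᶜ`. -/
theorem IsSplitting.not_reachable_of_minimal (hA : G.IsSplitting P A)
    (hmin : ∀ A' ⊂ A, ¬ G.IsSplitting P A') {w s t : V} (hw : w ∈ A)
    (hwC : ∃ c ∉ A, G.Adj w c) (hst : s ≠ t) (hs : P s) (ht : P t) (htA : t ∈ A \ {w}) :
    ¬ (G.within (A \ {w})).Reachable s t := by
  intro hreach
  set A' : Set V := {x | (G.within (A \ {w})).Reachable x t} with hA'
  have hsub : A' ⊆ A \ {w} := fun x hx => mem_of_reachable_within hx htA
  refine hmin A' ⟨fun x hx => (hsub hx).1, fun h => (hsub (h hw)).2 rfl⟩ ?_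
  have hwA' : w ∈ A'ᶜ := fun h => (hsub h).2 rfl
  refine ⟨connectedOn_component _ _, ?_, ⟨w, hwA'⟩,
    s, hreach, t, Reachable.refl t, hst, hs, ht⟩
  refine connectedOn_of_reachable (y := w) fun x hx => ?_
  by_cases hxA : x ∈ A
  · refine Reachable.head_induction (P := fun x => x ∈ A'ᶜ → (G.within A'ᶜ).Reachable x w)
      (hA.connected x hxA w hw) (fun _ => Reachable.refl w) ?_ hx
    intro a b hab hb ih ha
    by_cases haw : a = w
    · rw [haw]
    have hb' : b ∈ A'ᶜ := by
      intro hbA'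
      exact ha (Reachable.trans (Adj.reachable (G := G.within _)
        ⟨hab.1, ⟨hab.2.1, haw⟩, hsub hbA'⟩) hbA')
    exact Reachable.trans (Adj.reachable (G := G.within _) ⟨hab.1, ha, hb'⟩) (ih hb')
  · obtain ⟨c, hc, hwc⟩ := hwC
    have hCA' : Aᶜ ⊆ A'ᶜ := fun y hy h => hy (hsub h).1
    exact ((hA.compl_connected x hxA c hc).mono (within_mono hCA')).trans
      (Adj.reachable (G := G.within _) ⟨hwc.symm, hCA' hc, hwA'⟩)

/-- A component `B` of the vertices without outside neighbours has at least three boundary vertices,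
all in `A` with outside neighbours. Each of `s`, `t` is cut off from `B` by at most one of them, so
deleting some third one leaves `s` and `t` joined, against minimality. -/
theorem IsSplitting.exists_adj_compl_of_minimal [Fintype V] (hG : G.IsVertexConnected 3)
    (hA : G.IsSplitting P A) (hmin : ∀ A' ⊂ A, ¬ G.IsSplitting P A') :
    ∀ a ∈ A, ∃ c ∉ A, G.Adj a c := by
  classical
  intro a haA
  by_contra hac
  set D : Set V := {x | x ∈ A ∧ ¬ ∃ c ∉ A, G.Adj x c} with hD
  set B : Set V := {x | (G.within D).Reachable x a} with hB
  have haD : a ∈ D := ⟨haA, hac⟩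
  have hBD : B ⊆ D := fun x hx => mem_of_reachable_within hx haD
  have haB : a ∈ B := Reachable.refl a
  have hBA : B ⊆ A := fun x hx => (hBD hx).1
  set N : Finset V := Finset.univ.filter fun w => w ∉ B ∧ ∃ x ∈ B, G.Adj x w with hN
  obtain ⟨c, hc⟩ := hA.compl_nonempty
  have hcard : 3 ≤ N.card := hG.le_card_boundary haB (fun h => hc (hBA h))
    (fun x hx hxc => (hBD hx).2 ⟨c, hc, hxc⟩) N (by simp [hN])
  have hNA : ∀ w ∈ N, w ∉ B ∧ (∃ x ∈ B, G.Adj x w) ∧ w ∈ A ∧ ∃ c ∉ A, G.Adj w c := by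
    intro w hw
    obtain ⟨hwB, x, hx, hxw⟩ := (Finset.mem_filter.1 hw).2
    have hwA : w ∈ A := by
      by_contra hwA
      exact (hBD hx).2 ⟨w, hwA, hxw⟩
    refine ⟨hwB, ⟨x, hx, hxw⟩, hwA, ?_⟩
    by_contra hwc
    exact hwB (Reachable.trans (Adj.reachable (G := G.within _) ⟨hxw.symm, ⟨hwA, hwc⟩, hBD hx⟩) hx)
  obtain ⟨u, hu, v, hv, w, hw, huv, huw, hvw⟩ := Finset.two_lt_card.1 hcard
  have avoid : ∀ u ∈ N, ∀ v ∈ N, u ≠ v → ∀ x ∈ A,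
      (G.within (A \ {u})).Reachable x a ∨ (G.within (A \ {v})).Reachable x a := by
    intro u hu v hv huv x hx
    obtain ⟨hu1, hu2, hu3, -⟩ := hNA u hu
    obtain ⟨hv1, hv2, hv3, -⟩ := hNA v hv
    exact reachable_avoiding_one (connectedOn_component _ _) hBA haB hu3 hv3 hu1 hv1 huv hu2 hv2
      (hA.connected x hx a haA)
  obtain ⟨s, hs, t, ht, hst, hPs, hPt⟩ := hA.two
  have bad : ∀ u ∈ N, (G.within (A \ {u})).Reachable s a →
      (G.within (A \ {u})).Reachable t a → False := by
    intro u hu h1 h2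
    obtain ⟨hu1, -, hu3, hu4⟩ := hNA u hu
    have ha : a ∈ A \ {u} := ⟨haA, fun h => hu1 (h ▸ haB)⟩
    exact hA.not_reachable_of_minimal hmin hu3 hu4 hst hPs hPt
      (mem_of_reachable_within h2 ha) (h1.trans h2.symm)
  rcases avoid u hu v hv huv s hs with hs1 | hs1 <;>
  rcases avoid u hu v hv huv t ht with ht1 | ht1
  · exact bad u hu hs1 ht1
  · rcases avoid u hu w hw huw t ht with ht2 | ht2
    · exact bad u hu hs1 ht2
    rcases avoid v hv w hw hvw s hs with hs2 | hs2
    · exact bad v hv hs2 ht1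
    · exact bad w hw hs2 ht2
  · rcases avoid u hu w hw huw s hs with hs2 | hs2
    · exact bad u hu hs2 ht1
    rcases avoid v hv w hw hvw t ht with ht2 | ht2
    · exact bad v hv hs1 ht2
    · exact bad w hw hs2 ht2
  · exact bad v hv hs1 ht1

/-- In a 3-connected graph, two vertices with `P` are ends of a connected set with connected
complement, all of whose vertices have neighbours in the complement. -/
theorem IsVertexConnected.exists_nonseparating [Fintype V] (hG : G.IsVertexConnected 3)
    (hP : ∃ x y, x ≠ y ∧ P x ∧ P y) :
    ∃ (A : Set V) (s t p : V), s ∈ A ∧ t ∈ A ∧ s ≠ t ∧ P s ∧ P t ∧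
      (∀ x ∈ A, x ≠ s → x ≠ t → ¬ P x) ∧ (∀ q, q ∈ A ∧ G.Adj s q ↔ q = p) ∧
      (∀ x ∈ A, ∃ c ∉ A, G.Adj x c) ∧ G.ConnectedOn A ∧ G.ConnectedOn Aᶜ := by
  classical
  have hex : ∃ A, G.IsSplitting P A := by
    obtain ⟨x, y, hxy, hx, hy⟩ := hP
    have hlt : ({x, y} : Finset V).card < Fintype.card V := by
      have h1 := hG.1
      rw [ENat.card_eq_coe_fintype_card] at h1
      have h2 : 3 < Fintype.card V := by exact_mod_cast h1
      have := Finset.card_le_two (a := x) (b := y)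
      omega
    obtain ⟨c, -, hc⟩ := Finset.exists_mem_notMem_of_card_lt_card
      (t := (Finset.univ : Finset V)) (s := {x, y}) (by simpa using hlt)
    simp only [Finset.mem_insert, Finset.mem_singleton, not_or] at hc
    refine ⟨{c}ᶜ, by simpa using hG.connectedOn {c} (by simp), ?_, ⟨c, by simp⟩,
      x, by simpa using Ne.symm hc.1, y, by simpa using Ne.symm hc.2, hxy, hx, hy⟩
    rintro a ha b hb
    simp only [compl_compl, Set.mem_singleton_iff] at ha hb
    rw [ha, hb]
  obtain ⟨A, hA, hmin'⟩ := (Set.toFinite {A | G.IsSplitting P A}).exists_minimal hex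
  have hmin : ∀ A' ⊂ A, ¬ G.IsSplitting P A' := fun A' hlt hA' => hlt.2 (hmin' hA' hlt.1)
  have hadj := hA.exists_adj_compl_of_minimal hG hmin
  have hsep : ∀ w ∈ A, ∀ s t, s ≠ t → P s → P t → t ∈ A \ {w} →
      ¬ (G.within (A \ {w})).Reachable s t := fun w hw s t hst hs ht htA =>
    hA.not_reachable_of_minimal hmin hw (hadj w hw) hst hs ht htA
  obtain ⟨t', ht', t, ht, htt, hPt', hPt⟩ := hA.two
  obtain ⟨par, rank, hpar⟩ := exists_parent fun x hx => hA.connected x hx t ht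
  -- A vertex of maximal rank is a leaf of the tree rooted at `t`, so `A \ {s}` stays connected and
  -- can contain no second vertex with `P`.
  obtain ⟨s, hs, hmax⟩ := (Finset.univ.filter fun x => x ∈ A ∧ x ≠ t).exists_max_image rank
    ⟨t', by simp [ht', htt]⟩
  simp only [Finset.mem_filter, Finset.mem_univ, true_and] at hs hmax
  have hreach : ∀ n, ∀ x ∈ A \ {s}, rank x = n → (G.within (A \ {s})).Reachable x t := by
    intro n
    induction n using Nat.strong_induction_on with
    | _ n ih =>
      intro x hx hn
      by_cases hxt : x = t
      · rw [hxt]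
      obtain ⟨h1, h2⟩ := hpar x hx.1 hxt
      have h3 : par x ≠ s := by
        intro h
        have := hmax x ⟨hx.1, hxt⟩
        rw [h] at h2
        omega
      exact Reachable.trans (Adj.reachable (G := G.within _) ⟨h1.1, hx, h1.2.2, h3⟩)
        (ih _ (hn ▸ h2) _ ⟨h1.2.2, h3⟩ rfl)
  have htS : t ∈ A \ {s} := ⟨ht, hs.2.symm⟩
  have honly : ∀ x ∈ A, x ≠ s → x ≠ t → ¬ P x := fun x hx hxs hxt hPx =>
    hsep s hs.1 x t hxt hPx hPt htS (hreach _ x ⟨hx, hxs⟩ rfl)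
  have hPs : P s := by
    by_contra h
    exact honly t' ht' (fun h' => h (h' ▸ hPt')) htt hPt'
  obtain ⟨p, hp⟩ : ∃ p, (G.within A).Adj s p := ⟨par s, (hpar s hs.1 hs.2).1⟩
  refine ⟨A, s, t, p, hs.1, ht, hs.2, hPs, hPt, honly, ?_, hadj, hA.connected,
    hA.compl_connected⟩
  refine fun q => ⟨fun ⟨hq, hsq⟩ => ?_, fun h => h ▸ ⟨hp.2.2, hp.1⟩⟩
  -- With two neighbours of `s` in `A`, one could be deleted leaving `t` joined to `s`.
  by_contra hqp
  have hs' : G.ConnectedOn {s} := by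
    rintro a rfl b rfl
    exact Reachable.refl _
  rcases reachable_avoiding_one (A := A) hs' (by simpa using hs.1) rfl hq hp.2.2
    (by simpa using hsq.ne') (by simpa using hp.1.ne') hqp ⟨s, rfl, hsq⟩ ⟨s, rfl, hp.1⟩
    (hA.connected t ht s hs.1) with h | h
  · exact hsep q hq t s hs.2.symm hPt hPs ⟨hs.1, hsq.ne⟩ h
  · exact hsep p hp.2.2 t s hs.2.symm hPt hPs ⟨hs.1, hp.1.ne⟩ h

end Splitting

/-! ### Edge sets with prescribed parities -/

section ZModTwo

theorem zmod_two_add_self (a : ZMod 2) : a + a = 0 := CharTwo.add_self_eq_zero a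

theorem zmod_two_eq_zero_or_one (a : ZMod 2) : a = 0 ∨ a = 1 := by
  revert a
  decide

/-- Handshake lemma mod 2: `(a, b)` cancels against `(b, a)`. -/
theorem sum_sum_eq_zero_of_symm [Fintype V] (h : V → V → ZMod 2) (hs : ∀ a b, h a b = h b a)
    (h0 : ∀ a, h a a = 0) : ∑ a, ∑ b, h a b = 0 := by
  rw [← Fintype.sum_prod_type']
  refine Finset.sum_involution (fun x _ => x.swap) ?_ ?_ (fun _ _ => Finset.mem_univ _)
    (fun _ _ => Prod.swap_swap _)
  · rintro ⟨a, b⟩ -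
    simp only [Prod.swap_prod_mk]
    rw [hs b a, zmod_two_add_self]
  · rintro ⟨a, b⟩ - hab heq
    simp only [Prod.swap_prod_mk, Prod.mk.injEq] at heq
    obtain ⟨rfl, -⟩ := heq
    exact hab (h0 _)

/-- Add the edges of a walk mod 2; only its ends keep odd degree. -/
theorem exists_sum_eq_of_reachable [Fintype V] [DecidableEq V] {H : SimpleGraph V} {x r : V}
    (h : H.Reachable x r) : ∃ y : V → V → ZMod 2, (∀ a b, y a b = y b a) ∧
      (∀ a b, ¬ H.Adj a b → y a b = 0) ∧
      ∀ z, ∑ b, y z b = (if z = x then 1 else 0) + (if z = r then 1 else 0) := by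
  refine h.head_induction (P := fun x => ∃ y : V → V → ZMod 2, (∀ a b, y a b = y b a) ∧
      (∀ a b, ¬ H.Adj a b → y a b = 0) ∧
      ∀ z, ∑ b, y z b = (if z = x then 1 else 0) + (if z = r then 1 else 0)) ?_ ?_
  · exact ⟨fun _ _ => 0, fun _ _ => rfl, fun _ _ _ => rfl, fun z => by
      rw [zmod_two_add_self, Finset.sum_const_zero]⟩
  · rintro a b hab - ⟨y, hsymm, hsupp, hsum⟩
    refine ⟨fun u v => y u v + ((if u = a then if v = b then 1 else 0 else 0) +
      (if v = a then if u = b then 1 else 0 else 0)), fun u v => ?_, fun u v huv => ?_,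
      fun z => ?_⟩
    · beta_reduce
      rw [hsymm u v, add_comm (if u = a then _ else _)]
    · beta_reduce
      rw [hsupp u v huv]
      have h1 : ¬ (u = a ∧ v = b) := fun h => huv (h.1 ▸ h.2 ▸ hab)
      have h2 : ¬ (v = a ∧ u = b) := fun h => huv (h.1 ▸ h.2 ▸ hab.symm)
      simp only [← ite_and, h1, h2, if_false, add_zero]
    · rw [Finset.sum_add_distrib, hsum, Finset.sum_add_distrib]
      have h1 : ∑ v, (if z = a then if v = b then (1 : ZMod 2) else 0 else 0) =
          if z = a then 1 else 0 := by
        split_ifs <;> simp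
      have h2 : ∑ v, (if v = a then if z = b then (1 : ZMod 2) else 0 else 0) =
          if z = b then 1 else 0 := by
        simp
      rw [h1, h2]
      linear_combination zmod_two_add_self (if z = b then 1 else 0)

/-- A connected graph has a set of edges with prescribed parities at the vertices. -/
theorem exists_sum_eq [Fintype V] {H : SimpleGraph V} {W : Set V} {r : V}
    (h : ∀ x ∈ W, H.Reachable x r) (f : V → ZMod 2) (hf : ∀ x ∉ W, f x = 0)
    (hsum : ∑ x, f x = 0) : ∃ y : V → V → ZMod 2, (∀ a b, y a b = y b a) ∧
      (∀ a b, ¬ H.Adj a b → y a b = 0) ∧ ∀ z, ∑ b, y z b = f z := by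
  classical
  have key : ∀ x, ∃ y : V → V → ZMod 2, (∀ a b, y a b = y b a) ∧
      (∀ a b, ¬ H.Adj a b → y a b = 0) ∧ ∀ z, f x * ∑ b, y z b =
        f x * ((if z = x then 1 else 0) + (if z = r then 1 else 0)) := by
    intro x
    by_cases hx : x ∈ W
    · obtain ⟨y, h1, h2, h3⟩ := exists_sum_eq_of_reachable (h x hx)
      exact ⟨y, h1, h2, fun z => by rw [h3]⟩
    · exact ⟨fun _ _ => 0, fun _ _ => rfl, fun _ _ _ => rfl, fun z => by simp [hf x hx]⟩
  choose y h1 h2 h3 using key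
  -- Superpose the walks to `r` from all `x` with `f x = 1`; the surplus collected at `r` is `∑ f =
  -- 0`.
  refine ⟨fun a b => ∑ x, f x * y x a b, fun a b => ?_, fun a b hab => ?_, fun z => ?_⟩
  · simp only [h1 _ a b]
  · simp only [h2 _ a b hab, mul_zero, Finset.sum_const_zero]
  · rw [Finset.sum_comm]
    simp only [← Finset.mul_sum, h3]
    simp only [mul_add, Finset.sum_add_distrib, ← Finset.sum_mul, hsum]
    simp

/-- The two fibres of a 0-1-colouring `y` of `N` are empty or odd. -/
def OddFibers (N : Finset V) (y : V → ZMod 2) : Prop :=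
  (Odd N.card ∧ ∃ k, ∀ w ∈ N, y w = k) ∨ (Even N.card ∧ ∑ w ∈ N, y w = 1) ∨ N = ∅

theorem OddFibers.card_filter [DecidableEq V] {N : Finset V} {y : V → ZMod 2}
    (h : OddFibers N y) (k : ZMod 2) :
    (N.filter fun w => y w = k).card = 0 ∨ Odd (N.filter fun w => y w = k).card := by
  rcases h with ⟨hN, l, hl⟩ | ⟨hN, hsum⟩ | rfl
  · by_cases hk : l = k
    · right
      rwa [Finset.filter_true_of_mem fun w hw => hk ▸ hl w hw]
    · left
      rw [Finset.filter_false_of_mem fun w hw h => hk (hl w hw ▸ h), Finset.card_empty]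
  · right
    have h1 : Odd (N.filter fun w => y w = 1).card := by
      refine ZMod.natCast_eq_one_iff_odd.1 (Eq.trans ?_ hsum)
      rw [Finset.natCast_card_filter]
      refine Finset.sum_congr rfl fun w _ => ?_
      rcases zmod_two_eq_zero_or_one (y w) with h | h <;> simp [h]
    rcases zmod_two_eq_zero_or_one k with rfl | rfl
    · have h2 := Finset.card_filter_add_card_filter_not (s := N) (fun w => y w = 1)
      have h3 : (N.filter fun w => ¬ y w = 1) = N.filter fun w => y w = 0 := by
        refine Finset.filter_congr fun w _ => ?_
        rcases zmod_two_eq_zero_or_one (y w) with h | h <;> simp [h]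
      rw [h3] at h2
      rw [← h2] at hN
      exact (Nat.even_add.1 hN).not.1 (Nat.not_even_iff_odd.2 h1) |> Nat.not_even_iff_odd.1
    · exact h1
  · simp

end ZModTwo

/-! ### From parity conditions to colourings -/

section Coloring

theorem oddEdgeColorable_of_symm [Fintype V] {k : ℕ} [DecidableRel G.Adj] (col : V → V → Fin k)
    (hsymm : ∀ a b, col a b = col b a)
    (h : ∀ v i, (Finset.univ.filter fun w => G.Adj v w ∧ col v w = i).card = 0 ∨
      Odd (Finset.univ.filter fun w => G.Adj v w ∧ col v w = i).card) :
    G.OddEdgeColorable k := by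
  refine ⟨fun e => Sym2.lift ⟨col, hsymm⟩ e.1, fun i _ v hv => ?_⟩
  set H := G.edgeInducedSubgraph ((fun e : G.edgeSet => Sym2.lift ⟨col, hsymm⟩ e.1) ⁻¹' {i})
  have hset : H.neighborSet v =
      ((Finset.univ.filter fun w => G.Adj v w ∧ col v w = i : Finset V) : Set V) := by
    ext w
    simp only [Finset.coe_filter, Finset.mem_univ, true_and, Set.mem_ofPred_eq]
    constructor
    · rintro ⟨⟨e, he⟩, hei, rfl : e = s(v, w)⟩
      exact ⟨he, hei⟩
    · rintro ⟨hadj, hi⟩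
      exact ⟨⟨s(v, w), hadj⟩, hi, rfl⟩
  rw [hset, Set.ncard_coe_finset]
  refine (h v i).resolve_left fun h0 => ?_
  obtain ⟨⟨e, he⟩, hei, hve⟩ := hv
  obtain ⟨w, rfl⟩ : ∃ w, e = s(v, w) := Sym2.mem_iff_exists.1 hve
  rw [Finset.card_eq_zero, Finset.filter_eq_empty_iff] at h0
  exact h0 (Finset.mem_univ w) ⟨he, hei⟩

/-- One odd class `h = 1`, and two classes that split the edges with `h = 0`. -/
theorem oddEdgeColorable_three [Fintype V] [DecidableRel G.Adj] (h y : V → V → ZMod 2)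
    (hsymm : ∀ a b, h a b = h b a) (ysymm : ∀ a b, y a b = y b a)
    (hsupp : ∀ a b, ¬ G.Adj a b → h a b = 0)
    (hh : ∀ v, ∑ w, h v w = 1 ∨ ∀ w, h v w = 0)
    (hy : ∀ v, OddFibers (Finset.univ.filter fun w => G.Adj v w ∧ h v w = 0) (y v)) :
    G.OddEdgeColorable 3 := by
  classical
  refine oddEdgeColorable_of_symm
    (fun a b => if h a b = 1 then 0 else if y a b = 0 then 1 else 2)
    (fun a b => by rw [hsymm a b, ysymm a b]) fun v i => ?_
  have hrest : ∀ k : ZMod 2,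
      (Finset.univ.filter fun w => G.Adj v w ∧ h v w = 0 ∧ y v w = k).card = 0 ∨
      Odd (Finset.univ.filter fun w => G.Adj v w ∧ h v w = 0 ∧ y v w = k).card := by
    intro k
    have := (hy v).card_filter k
    simpa only [Finset.filter_filter, and_assoc] using this
  fin_cases i
  · have heq : (Finset.univ.filter fun w => G.Adj v w ∧
        (if h v w = 1 then (0 : Fin 3) else if y v w = 0 then 1 else 2) = 0) =
        Finset.univ.filter fun w => h v w = 1 := by
      refine Finset.filter_congr fun w _ => ?_
      by_cases hvw : h v w = 1
      · simp only [hvw, if_true, and_true, iff_true]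
        by_contra hadj
        rw [hsupp v w hadj] at hvw
        exact zero_ne_one hvw
      · simp only [hvw, if_false, iff_false, not_and]
        intro _
        split_ifs <;> decide
    change (Finset.univ.filter fun w => G.Adj v w ∧
        (if h v w = 1 then (0 : Fin 3) else if y v w = 0 then 1 else 2) = 0).card = 0 ∨
      Odd (Finset.univ.filter fun w => G.Adj v w ∧
        (if h v w = 1 then (0 : Fin 3) else if y v w = 0 then 1 else 2) = 0).card
    rw [heq]
    rcases hh v with h1 | h1
    · right
      refine ZMod.natCast_eq_one_iff_odd.1 (Eq.trans ?_ h1)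
      rw [Finset.natCast_card_filter]
      refine Finset.sum_congr rfl fun w _ => ?_
      rcases zmod_two_eq_zero_or_one (h v w) with h | h <;> simp [h]
    · left
      simp [h1]
  · convert hrest 0 using 3
    all_goals
      refine Finset.filter_congr fun w _ => ?_
      rcases zmod_two_eq_zero_or_one (h v w) with h | h <;>
      rcases zmod_two_eq_zero_or_one (y v w) with h' | h' <;> simp [h, h']
  · convert hrest 1 using 3
    all_goals
      refine Finset.filter_congr fun w _ => ?_
      rcases zmod_two_eq_zero_or_one (h v w) with h | h <;>
      rcases zmod_two_eq_zero_or_one (y v w) with h' | h' <;> simp [h, h']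

theorem exists_recursion {X : Type*} [Zero X] (par : V → V) (rank : V → ℕ) (Q : V → Prop)
    [DecidablePred Q] (hQ : ∀ x, Q x → rank (par x) < rank x) (g : V → X → X) :
    ∃ col : V → X, ∀ x, col x = if Q x then g x (col (par x)) else 0 := by
  refine ⟨(measure rank).wf.fix fun x ih => if hx : Q x then g x (ih (par x) (hQ x hx)) else 0,
    fun x => ?_⟩
  rw [WellFounded.fix_eq]
  split_ifs <;> rfl

/-- If the edges of `K` at the vertices of `C` form a forest, directed to its roots by `par`,
apart from edges to `t`, then `K` has a 0-1-colouring that is good at all vertices of `C`. -/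
theorem exists_oddFibers_of_parent [Fintype V] (K : SimpleGraph V) [DecidableRel K.Adj]
    (par : V → V) (rank : V → ℕ) (Q : V → Prop) (t : V) (C : Set V)
    (hrank : ∀ x, Q x → rank (par x) < rank x) (hpt : ∀ x, Q x → par x ≠ t)
    (hK : ∀ x, Q x → K.Adj x (par x)) (htC : t ∉ C)
    (hC : ∀ c ∈ C, ∀ w, K.Adj c w → w = t ∨ (Q c ∧ par c = w) ∨ (Q w ∧ par w = c)) :
    ∃ y : V → V → ZMod 2, (∀ a b, y a b = y b a) ∧
      ∀ c ∈ C, OddFibers (Finset.univ.filter fun w => K.Adj c w) (y c) := by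
  classical
  set N : V → Finset V := fun c => Finset.univ.filter fun w => K.Adj c w with hN
  have hmemN : ∀ c w, w ∈ N c ↔ K.Adj c w := fun c w => by simp [hN]
  -- A non-zero even degree is at least 2, which leaves a special edge other than the parent edge.
  have hsp : ∀ c, ∃ w, Even (N c).card → (N c).Nonempty → w ∈ N c ∧ ¬ (Q c ∧ w = par c) := by
    intro c
    by_cases hc : Even (N c).card ∧ (N c).Nonempty
    · have h1 : 1 < (N c).card := by
        have := hc.2.card_pos
        obtain ⟨k, hk⟩ := hc.1
        omega
      obtain ⟨w, hw, hwc⟩ := Finset.exists_mem_ne h1 (par c)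
      exact ⟨w, fun _ _ => ⟨hw, fun h => hwc h.2⟩⟩
    · exact ⟨c, fun h1 h2 => absurd ⟨h1, h2⟩ hc⟩
  choose sp hsp using hsp
  -- If the parent edge of `c` has colour `a`, the others all get `a` when the degree is odd. When
  -- it is even they get 0, except `1 + a` on the special edge, which makes the sum 1. Roots use `a
  -- = 0`.
  let own : V → V → ZMod 2 → ZMod 2 := fun c x a =>
    if Odd (N c).card then a else if sp c = x then 1 + a else 0
  obtain ⟨col, hcol⟩ := exists_recursion par rank Q hrank fun x a => own (par x) x a
  -- The part of the colouring decided by `c`: edges to its children, and its edge to `t`, which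
  -- counts as one more child.
  let φ : V → V → ZMod 2 := fun c x =>
    if (Q x ∧ par x = c) ∨ (x = t ∧ c ≠ t) then own c x (col c) else 0
  refine ⟨fun a b => φ a b + φ b a, fun a b => add_comm _ _, fun c hc => ?_⟩
  have hct : c ≠ t := fun h => htC (h ▸ hc)
  have hval : ∀ w ∈ N c, φ c w + φ w c = if Q c ∧ w = par c then col c else own c w (col c) := by
    intro w hw
    by_cases h : Q c ∧ w = par c
    · obtain ⟨hQc, rfl⟩ := h
      have h1 : ¬ ((Q (par c) ∧ par (par c) = c) ∨ (par c = t ∧ c ≠ t)) := by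
        rintro (⟨h1, h2⟩ | ⟨h1, -⟩)
        · have h3 := hrank _ h1
          have h4 := hrank _ hQc
          rw [h2] at h3
          omega
        · exact hpt c hQc h1
      have h2 : (Q c ∧ par c = par c) ∨ (c = t ∧ par c ≠ t) := Or.inl ⟨hQc, rfl⟩
      simp only [φ, if_neg h1, if_pos h2, zero_add]
      rw [if_pos ⟨hQc, trivial⟩, hcol c, if_pos hQc]
    · have h1 : (Q w ∧ par w = c) ∨ (w = t ∧ c ≠ t) := by
        rcases hC c hc w ((hmemN c w).1 hw) with h' | h' | h'
        · exact Or.inr ⟨h', hct⟩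
        · exact absurd ⟨h'.1, h'.2.symm⟩ h
        · exact Or.inl h'
      have h2 : ¬ ((Q c ∧ par c = w) ∨ (c = t ∧ w ≠ t)) := by
        rintro (⟨h2, h3⟩ | ⟨h2, -⟩)
        · exact h ⟨h2, h3.symm⟩
        · exact hct h2
      simp only [φ, if_pos h1, if_neg h2, add_zero, if_neg h]
  by_cases hodd : Odd (N c).card
  · refine Or.inl ⟨hodd, col c, fun w hw => ?_⟩
    refine (hval w hw).trans ?_
    simp only [own, if_pos hodd, ite_self]
  rcases (N c).eq_empty_or_nonempty with hempty | hne
  · exact Or.inr (Or.inr hempty)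
  have heven := Nat.not_odd_iff_even.1 hodd
  obtain ⟨hs1, hs2⟩ := hsp c heven hne
  refine Or.inr (Or.inl ⟨heven, ?_⟩)
  have hval' : ∀ w ∈ N c, φ c w + φ w c =
      (if par c = w then (if Q c then col c else 0) else 0) +
      (if sp c = w then 1 + col c else 0) := by
    intro w hw
    rw [hval w hw]
    simp only [own, if_neg hodd]
    by_cases h : Q c ∧ w = par c
    · have h3 : sp c ≠ w := fun h' => hs2 ⟨h.1, h'.trans h.2⟩
      rw [if_pos h, if_pos h.2.symm, if_pos h.1, if_neg h3, add_zero]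
    · rw [if_neg h]
      by_cases h3 : par c = w
      · have h4 : ¬ Q c := fun h4 => h ⟨h4, h3.symm⟩
        simp [h4]
      · simp [h3]
  rw [Finset.sum_congr rfl hval', Finset.sum_add_distrib, Finset.sum_ite_eq, Finset.sum_ite_eq,
    if_pos hs1]
  by_cases hQc : Q c
  · rw [if_pos ((hmemN _ _).2 (hK c hQc)), if_pos hQc]
    linear_combination zmod_two_add_self (col c)
  · rw [hcol c, if_neg hQc, if_neg hQc, ite_self]
    simp

end Coloring

/-! ### Constructing the three colour classes -/

theorem oddEdgeColorable_three_of_nonseparating [Fintype V] [DecidableRel G.Adj]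
    (hodd : Odd (Fintype.card V)) {A : Set V} {s t p : V} (hsA : s ∈ A) (htA : t ∈ A)
    (hst : s ≠ t) (hs : Even (G.degree s)) (ht : Even (G.degree t))
    (hA : ∀ x ∈ A, x ≠ s → x ≠ t → ¬ Even (G.degree x))
    (hp : ∀ q, q ∈ A ∧ G.Adj s q ↔ q = p) (hadj : ∀ x ∈ A, ∃ c ∉ A, G.Adj x c)
    (hAconn : G.ConnectedOn A) (hCconn : G.ConnectedOn Aᶜ) : G.OddEdgeColorable 3 := by
  classical
  obtain ⟨hpA, hsp⟩ := (hp p).2 rfl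
  obtain ⟨r, hr, -⟩ := hadj s hsA
  set W : Set V := {x | x ≠ s ∧ x ≠ t} with hW
  have hCW : ∀ x ∉ A, x ∈ W := fun x hx =>
    ⟨fun h => hx (h ▸ hsA), fun h => hx (h ▸ htA)⟩
  let G₁ : SimpleGraph V :=
    { Adj := fun x y => G.Adj x y ∧ (x ∈ W ∧ y ∈ W) ∧ (x ∉ A ∨ y ∉ A)
      symm := ⟨fun _ _ h => ⟨h.1.symm, h.2.1.symm, h.2.2.symm⟩⟩
      loopless := ⟨fun _ h => h.1.ne rfl⟩ }
  have hG₁ : ∀ x y, G₁.Adj x y ↔ G.Adj x y ∧ (x ∈ W ∧ y ∈ W) ∧ (x ∉ A ∨ y ∉ A) :=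
    fun _ _ => Iff.rfl
  have hreachC : ∀ x ∉ A, G₁.Reachable x r := fun x hx => (hCconn x hx r hr).mono
    fun a b (hab : (G.within Aᶜ).Adj a b) => ⟨hab.1, ⟨hCW a hab.2.1, hCW b hab.2.2⟩, Or.inl hab.2.1⟩
  have hreach : ∀ x ∈ W, G₁.Reachable x r := by
    intro x hx
    by_cases hxA : x ∈ A
    · obtain ⟨c, hc, hxc⟩ := hadj x hxA
      exact Reachable.trans (Adj.reachable ((hG₁ x c).2 ⟨hxc, ⟨hx, hCW c hc⟩, Or.inr hc⟩))
        (hreachC c hc)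
    · exact hreachC x hxA
  obtain ⟨par, rank, hpar⟩ := exists_parent hreach
  -- the spanning tree
  let Tr : SimpleGraph V := fromRel fun x y => (x ∈ W ∧ x ≠ r) ∧ par x = y
  have hTr : ∀ x y, Tr.Adj x y ↔ ((x ∈ W ∧ x ≠ r) ∧ par x = y) ∨ ((y ∈ W ∧ y ≠ r) ∧ par y = x) := by
    intro x y
    rw [fromRel_adj, and_iff_right_iff_imp]
    rintro (⟨⟨h1, h2⟩, rfl⟩ | ⟨⟨h1, h2⟩, rfl⟩)
    · exact (hpar _ h1 h2).1.ne
    · exact (hpar _ h1 h2).1.ne'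
  have hTrG₁ : ∀ x y, Tr.Adj x y → G₁.Adj x y := by
    intro x y h
    rcases (hTr x y).1 h with ⟨⟨h1, h2⟩, rfl⟩ | ⟨⟨h1, h2⟩, rfl⟩
    · exact (hpar _ h1 h2).1
    · exact (hpar _ h1 h2).1.symm
  have hTrreach : ∀ n, ∀ x ∈ W, rank x = n → Tr.Reachable x r := by
    intro n
    induction n using Nat.strong_induction_on with
    | _ n ih =>
      intro x hx hn
      by_cases hxr : x = r
      · rw [hxr]
      obtain ⟨h1, h2⟩ := hpar x hx hxr
      exact Reachable.trans (Adj.reachable ((hTr x (par x)).2 (Or.inl ⟨⟨hx, hxr⟩, rfl⟩)))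
        (ih _ (hn ▸ h2) _ h1.2.1.2 rfl)
  -- the odd subgraph, before the parities are corrected along the tree
  let h₀ : V → V → ZMod 2 := fun x y =>
    if G.Adj x y ∧ (x ≠ t ∧ y ≠ t) ∧ (x ∉ A ∨ y ∉ A) ∧ ¬ Tr.Adj x y then 1 else 0
  have h₀symm : ∀ x y, h₀ x y = h₀ y x := by
    intro x y
    simp only [h₀]
    congr 1
    rw [G.adj_comm, Tr.adj_comm, and_comm (a := x ≠ t), or_comm]
  have h₀sum : ∑ x, ∑ y, h₀ x y = 0 :=
    sum_sum_eq_zero_of_symm h₀ h₀symm fun x => by simp [h₀]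
  have hdeg : ∀ x, ∑ y, (if G.Adj x y then (1 : ZMod 2) else 0) = G.degree x := by
    intro x
    rw [← Finset.natCast_card_filter, ← card_neighborFinset_eq_degree, neighborFinset_eq_filter]
  -- The tree misses `s`, so its parity must be right from the start: of an even number of edges
  -- exactly `sp` is dropped.
  have h₀s : ∑ y, h₀ s y = 1 := by
    have h1 : ∀ y, h₀ s y = (if G.Adj s y then (1 : ZMod 2) else 0) + if y = p then 1 else 0 := by
      intro y
      by_cases hyp : y = p
      · subst hyp
        simp only [h₀, hsA, hpA, hsp, not_true_eq_false, or_self, false_and, and_false, if_false,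
          if_true]
        exact (zmod_two_add_self 1).symm
      · by_cases hsy : G.Adj s y
        · have hyA : y ∉ A := fun h => hyp ((hp y).1 ⟨h, hsy⟩)
          have hTs : ¬ Tr.Adj s y := fun h => (hTrG₁ _ _ h).2.1.1.1 rfl
          have hyt : y ≠ t := (hCW y hyA).2
          simp [h₀, hsy, hst, hyt, hyA, hTs, hyp]
        · simp [h₀, hsy, hyp]
    simp only [h1, Finset.sum_add_distrib, hdeg, (ZMod.natCast_eq_zero_iff_even).2 hs]
    simp
  have h₀t : ∀ y, h₀ t y = 0 := fun y => by simp [h₀]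
  obtain ⟨J, Jsymm, Jsupp, Jsum⟩ := exists_sum_eq (H := Tr) (W := W) (r := r)
    (fun x hx => hTrreach _ x hx rfl)
    -- The deficit from degree 1 away from `t` and 0 at `t`; it vanishes at `s` and `t`, and sums to
    -- `|V| - 1 = 0`.
    (fun x => 1 - ∑ y, h₀ x y - if x = t then 1 else 0)
    (by
      intro x hx
      by_cases hxt : x = t
      · simp [hxt, h₀t]
      · have hxs : x = s := by
          by_contra h
          exact hx ⟨h, hxt⟩
        rw [hxs, h₀s, if_neg hst]
        simp)
    (by
      rw [Finset.sum_sub_distrib, Finset.sum_sub_distrib, h₀sum]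
      simp [(ZMod.natCast_eq_one_iff_odd).2 hodd])
  set h : V → V → ZMod 2 := fun x y => h₀ x y + J x y with hh
  have hsymm : ∀ x y, h x y = h y x := fun x y => by simp only [hh, h₀symm x y, Jsymm x y]
  have hsupp : ∀ x y, ¬ G.Adj x y → h x y = 0 := fun x y hxy => by
    have h1 : J x y = 0 := Jsupp x y fun h => hxy (hTrG₁ _ _ h).1
    simp [hh, h₀, h1, hxy]
  have ht0 : ∀ y, h t y = 0 := fun y => by
    have h1 : J t y = 0 := Jsupp t y fun h => (hTrG₁ _ _ h).2.1.1.2 rfl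
    simp [hh, h₀t, h1]
  have hsum : ∀ x, x ≠ t → ∑ y, h x y = 1 := fun x hx => by
    simp only [hh, Finset.sum_add_distrib, Jsum, if_neg hx]
    ring
  -- the remaining edges
  let K : SimpleGraph V :=
    { Adj := fun x y => G.Adj x y ∧ h x y = 0
      symm := ⟨fun x y hxy => ⟨hxy.1.symm, hsymm x y ▸ hxy.2⟩⟩
      loopless := ⟨fun _ h => h.1.ne rfl⟩ }
  have hK : ∀ x y, K.Adj x y ↔ G.Adj x y ∧ h x y = 0 := fun _ _ => Iff.rfl
  have hKA : ∀ x y, (G.within A).Adj x y → K.Adj x y := fun x y hxy => by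
    have h1 : J x y = 0 := Jsupp x y fun h => by
      have := (hTrG₁ _ _ h).2.2
      have := hxy.2
      tauto
    refine ⟨hxy.1, ?_⟩
    simp [hh, h₀, h1, hxy.2.1, hxy.2.2]
  have hKtree : ∀ x y, K.Adj x y → x ∉ A → y ≠ t → Tr.Adj x y := by
    intro x y hxy hx hy
    by_contra hT
    have h1 : J x y = 0 := Jsupp x y hT
    have h2 : h x y = 1 := by
      have hxt := (hCW x hx).2
      simp [hh, h₀, h1, hT, hxy.1, hx, hy, hxt]
    exact one_ne_zero (h2.symm.trans hxy.2)
  have hKcard : ∀ x, ((Finset.univ.filter fun y => K.Adj x y).card : ZMod 2) =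
      G.degree x - ∑ y, h x y := by
    intro x
    rw [← hdeg, ← Finset.sum_sub_distrib, Finset.natCast_card_filter]
    refine Finset.sum_congr rfl fun y _ => ?_
    simp only [hK]
    by_cases hxy : G.Adj x y
    · rcases zmod_two_eq_zero_or_one (h x y) with h' | h' <;> simp [hxy, h']
    · simp [hxy, hsupp x y hxy]
  have hKs : ∀ y, K.Adj s y → y = p := by
    intro y hy
    by_contra hyp
    have hyA : y ∉ A := fun h => hyp ((hp y).1 ⟨h, hy.1⟩)
    exact (hTrG₁ _ _ (hKtree y s hy.symm hyA hst)).2.1.2.1 rfl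
  -- The even vertex `t` loses no edges to the first class; the other vertices have odd degree and
  -- lose an odd number.
  have hKeven : ∀ x ∈ A, x ≠ s → Even (Finset.univ.filter fun y => K.Adj x y).card := by
    intro x hx hxs
    rw [← ZMod.natCast_eq_zero_iff_even, hKcard]
    by_cases hxt : x = t
    · subst hxt
      simp only [ht0, (ZMod.natCast_eq_zero_iff_even).2 ht, Finset.sum_const_zero, sub_zero]
    · rw [hsum x hxt, (ZMod.natCast_eq_one_iff_odd).2
        (Nat.not_even_iff_odd.1 (hA x hx hxs hxt)), sub_self]
  obtain ⟨y, ysymm, hy⟩ := exists_oddFibers_of_parent K par rank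
    (fun x => (x ∈ W ∧ x ≠ r) ∧ K.Adj x (par x)) t Aᶜ
    (fun x hx => (hpar x hx.1.1 hx.1.2).2) (fun x hx => (hpar x hx.1.1 hx.1.2).1.2.1.2.2)
    (fun x hx => hx.2) (fun h => h htA)
    (by
      intro c hc w hcw
      by_cases hwt : w = t
      · exact Or.inl hwt
      right
      rcases (hTr c w).1 (hKtree c w hcw hc hwt) with ⟨h1, rfl⟩ | ⟨h1, rfl⟩
      · exact Or.inl ⟨⟨h1, hcw⟩, rfl⟩
      · exact Or.inr ⟨⟨h1, hcw.symm⟩, rfl⟩)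
  -- correction along the edges inside `A`
  let f : V → ZMod 2 := fun x =>
    if x ∈ A ∧ x ≠ s then 1 - ∑ w ∈ Finset.univ.filter (fun w => K.Adj x w), y x w else 0
  -- Subtracting the total at `s` makes the prescribed parities sum to zero. The support inside `A`
  -- leaves the colours at vertices of `Aᶜ` untouched.
  obtain ⟨z, zsymm, zsupp, zsum⟩ := exists_sum_eq (H := G.within A) (W := A) (r := s)
    (fun x hx => hAconn x hx s hsA) (fun x => f x - if x = s then ∑ v, f v else 0)
    (by
      intro x hx
      have hxs : x ≠ s := fun h => hx (h ▸ hsA)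
      simp [f, hx, hxs])
    (by
      rw [Finset.sum_sub_distrib]
      simp)
  refine oddEdgeColorable_three h (fun a b => y a b + z a b) hsymm
    (fun a b => by rw [ysymm a b, zsymm a b]) hsupp (fun v => ?_) (fun v => ?_)
  · by_cases hvt : v = t
    · exact Or.inr fun w => hvt ▸ ht0 w
    · exact Or.inl (hsum v hvt)
  change OddFibers (Finset.univ.filter fun w => K.Adj v w) _
  by_cases hvA : v ∈ A
  · by_cases hvs : v = s
    · subst hvs
      have h1 : (Finset.univ.filter fun w => K.Adj v w) = {p} := by
        ext w
        simp only [Finset.mem_filter, Finset.mem_univ, true_and, Finset.mem_singleton]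
        exact ⟨hKs w, fun h => h ▸ hKA v p ⟨hsp, hvA, hpA⟩⟩
      rw [h1]
      exact Or.inl ⟨by simp, _, fun w hw => by rw [Finset.mem_singleton.1 hw]⟩
    · refine Or.inr (Or.inl ⟨hKeven v hvA hvs, ?_⟩)
      have h1 : ∑ w ∈ Finset.univ.filter (fun w => K.Adj v w), z v w = ∑ w, z v w := by
        refine Finset.sum_subset (Finset.subset_univ _) fun w _ hw => zsupp v w fun h => hw ?_
        simpa using hKA v w h
      rw [Finset.sum_add_distrib, h1, zsum]
      simp only [f, if_pos (⟨hvA, hvs⟩ : v ∈ A ∧ v ≠ s), if_neg hvs]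
      ring
  · have h1 : (fun w => y v w + z v w) = y v := by
      funext w
      rw [zsupp v w fun h => hvA h.2.1, add_zero]
    rw [h1]
    convert hy v hvA

end SimpleGraph

theorem mainTheorem2 {V : Type*} [Fintype V] (G : SimpleGraph V) [DecidableRel G.Adj]
    (hconn : G.IsVertexConnected 3) (hodd : Odd (Fintype.card V))
    (heven : 2 ≤ (Finset.univ.filter fun v : V => Even (G.degree v)).card) :
    G.oddChromaticIndex ≤ 3 := by
  obtain ⟨x, hx, y, hy, hxy⟩ := Finset.one_lt_card.1 heven
  obtain ⟨A, s, t, p, hs, ht, hst, hPs, hPt, hA, hp, hadj, h1, h2⟩ :=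
    hconn.exists_nonseparating (P := fun v => Even (G.degree v))
      ⟨x, y, hxy, (Finset.mem_filter.1 hx).2, (Finset.mem_filter.1 hy).2⟩
  have h3 : G.OddEdgeColorable 3 := SimpleGraph.oddEdgeColorable_three_of_nonseparating hodd
    hs ht hst hPs hPt hA hp hadj h1 h2
  exact iInf₂_le_of_le 3 h3 le_rfl
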